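/- Let $\kappa$ be a cardinal with $\omega\le\kappa<2^\omega$, and assume $MA_\kappa(\sigma\text{-centered})$, i.e.: whenever $P$ is a nonempty partial order that is a union of countably many subsets $C_n$ such that any finitely many elements of the same $C_n$ have a common lower bound in $P$, and $\mathcal D$ is a family of at most $\kappa$ dense subsets of $P$ (where $D\subseteq P$ is dense if for every $p\in P$ there is $q\in D$ with $q\le p$), there is a filter $G\subseteq P$ (nonempty, upward closed, downward directed) with $G\cap D\ne\emptyset$ for all $D\in\mathcal D$. Let $X$ be any of the spaces $\mathbb R$ (with its usual topology), $\omega^\omega$ or $2^\omega$ (with the product topology of discrete spaces). Then there is a family $\mathcal H$ of pairwise distinct closed subsets of $X$ such that 1. every $x\in X$ belongs to at least $\kappa$ members of $\mathcal H$ (that is, $\mathcal H$ is a $\kappa$-fold simple closed cover of $X$), and 2. there are no two disjoint subfamilies $\mathcal A,\mathcal B\subseteq\mathcal H$ such that $\bigcup\mathcal A=X=\bigcup\mathcal B$. Moreover, for $X=\mathbb R$ there are a compact set $K\subseteq\mathbb R$ and a family $\mathcal H$ satisfying 1 and 2 all of whose members are translates $K+d$ ($d\in\mathbb R$) of $K$.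 -/

import Mathlib

open scoped Cardinal

namespace SplittingCovers

/-- A partial order, read as a forcing notion (`q ≤ p` means that `q` extends `p`), is
`σ`-centered if it is a countable union of centered subsets, where a set is centered if any
finitely many of its members have a common extension in the order. -/
def SigmaCentered (P : Type) [PartialOrder P] : Prop :=
  ∃ C : ℕ → Set P, (⋃ n, C n) = Set.univ ∧
    ∀ n, ∀ F : Finset P, (F : Set P) ⊆ C n → ∃ q : P, ∀ p ∈ F, q ≤ p

/-- A subset `D` of a partial order is dense if every condition has an extension in `D`. -/
def DenseBelow {P : Type} [PartialOrder P] (D : Set P) : Prop :=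
  ∀ p : P, ∃ q ∈ D, q ≤ p

/-- `MA_κ(σ-centered)`: for every nonempty `σ`-centered partial order and every family of at most
`κ` dense subsets of it there is a filter (nonempty, upward closed, downward directed) that meets
every member of the family. -/
def MASigmaCentered (κ : Cardinal.{0}) : Prop :=
  ∀ (P : Type) [PartialOrder P] [Nonempty P], SigmaCentered P →
    ∀ 𝒟 : Set (Set P), #𝒟 ≤ κ → (∀ D ∈ 𝒟, DenseBelow D) →
      ∃ G : Order.PFilter P, ∀ D ∈ 𝒟, ∃ p ∈ G, p ∈ D

variable {X : Type}

/-- A simple cover is identified with the family of its members; it covers `X` if every point lies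
in some member. -/
def IsSimpleCover (𝓗 : Set (Set X)) : Prop :=
  ∀ x : X, ∃ H ∈ 𝓗, x ∈ H

/-- The family `𝓗` is a `κ`-fold cover of `X`: every point lies in at least `κ` distinct members. -/
def IsSimpleFoldCover (κ : Cardinal.{0}) (𝓗 : Set (Set X)) : Prop :=
  ∀ x : X, κ ≤ #{H : Set X // H ∈ 𝓗 ∧ x ∈ H}

/-- Two subfamilies of `𝓗` without a common member both cover `X`. -/
def HasTwoDisjointSubcovers (𝓗 : Set (Set X)) : Prop :=
  ∃ 𝓐 𝓑 : Set (Set X), 𝓐 ⊆ 𝓗 ∧ 𝓑 ⊆ 𝓗 ∧ Disjoint 𝓐 𝓑 ∧ IsSimpleCover 𝓐 ∧ IsSimpleCover 𝓑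

/-- `𝓗` is a `κ`-fold simple closed cover of `X` without two disjoint subcovers. -/
def IsUnsplittableClosedCover [TopologicalSpace X] (κ : Cardinal.{0}) (𝓗 : Set (Set X)) : Prop :=
  (∀ H ∈ 𝓗, IsClosed H) ∧ IsSimpleFoldCover κ 𝓗 ∧ ¬ HasTwoDisjointSubcovers 𝓗

end SplittingCovers

/-! Fix `κ` binary sequences `y` and let `Z` consist of all `0ⁿ1y`. Reading `x` as a set of numbers,
`x` avoids `z` if it contains no code of a prefix of `z` in which `true` occurs. The sets of such
codes are almost disjoint for `z ∈ Z`, so for each `c ⊆ Z` Martin's axiom gives an `x` that avoids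
only members of `c`, and avoids some `0ⁿ1y ∈ c` for every `y` with infinitely many such `n`
(`exists_avoiding_set`). If `Z` is split into two colours, each `y` has infinitely many `n` in one
of them, so one colour serves `κ` many `y`: some `x` avoids at least `κ` members of `Z`, all of one
colour (`exists_index_set`).

Hence the closed sets `{x | Avoids x z}` cannot be divided into two covers of the set `S` of points
lying in at least `κ` of them. Points outside `S` are covered by extra closed sets that miss `S`. In
a space containing a Cantor set, pairs suffice (`exists_unsplittable_of_cantor`). For translates,
Cantor sets of reals with unique short sums (`multiset_eq_of_sum_digitReal`) turn avoidance into
membership of a difference in one compact set, and a further Cantor set inside it supplies the extra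
translates. -/

namespace SplittingCovers

/-! ### Prefix codes and the avoidance relation. -/

section Coding

lemma bool_toNat_injective : Function.Injective Bool.toNat := by
  rintro (_ | _) (_ | _) <;> simp

/-- The natural number coding the restriction of the sequence `z` to its first `k` places. -/
def prefixCode {α : Type} [Encodable α] (z : ℕ → α) (k : ℕ) : ℕ :=
  Encodable.encode ((List.range k).map z)

lemma prefixCode_eq_iff {α : Type} [Encodable α] {z w : ℕ → α} {k l : ℕ} :
    prefixCode z k = prefixCode w l ↔ k = l ∧ ∀ j < k, z j = w j := by
  unfold prefixCode
  rw [Encodable.encode_inj]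
  constructor
  · intro h
    have hl : k = l := by simpa using congrArg List.length h
    subst hl
    refine ⟨rfl, fun j hj => ?_⟩
    exact (List.map_inj_left.1 h) j (List.mem_range.2 hj)
  · rintro ⟨rfl, h⟩
    exact List.map_inj_left.2 fun j hj => h j (List.mem_range.1 hj)

lemma eventually_prefixCode_inj {α : Type} [Encodable α] (z w : ℕ → α) :
    ∀ᶠ k in Filter.atTop, prefixCode z k = prefixCode w k → z = w := by
  by_cases h : z = w
  · exact Filter.Eventually.of_forall fun _ _ => h
  · obtain ⟨j, hj⟩ := Function.ne_iff.1 h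
    filter_upwards [Filter.eventually_gt_atTop j] with k hk hc
    exact absurd ((prefixCode_eq_iff.1 hc).2 j hk) hj

lemma continuous_comp_prefixCode {α β : Type} [Encodable α] [TopologicalSpace α]
    [DiscreteTopology α] [TopologicalSpace β] (g : ℕ → β) (k : ℕ) :
    Continuous fun z : ℕ → α => g (prefixCode z k) := by
  let res : (ℕ → α) → (Fin k → α) := fun z i => z i
  have hres : Continuous res := continuous_pi fun i => continuous_apply _
  have : (fun z : ℕ → α => g (prefixCode z k)) =
      (fun v : Fin k → α => g (Encodable.encode (List.ofFn v))) ∘ res := by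
    funext z
    simp only [Function.comp, prefixCode, res]
    congr 2
    apply List.ext_getElem <;> simp
  rw [this]
  exact continuous_of_discreteTopology.comp hres

/-- `x` contains no code of a prefix of `z` in which the value `true` occurs. -/
def Avoids (x z : ℕ → Bool) : Prop :=
  ∀ j k, j < k → z j = true → x (prefixCode z k) = false

/-- Near a given pair the code of a prefix of `z` is constant, so each clause depends on finitely
many coordinates. Closedness in both variables jointly is what makes `coverSet` compact. -/
lemma isClosed_avoids : IsClosed {p : (ℕ → Bool) × (ℕ → Bool) | Avoids p.1 p.2} := by
  have : {p : (ℕ → Bool) × (ℕ → Bool) | Avoids p.1 p.2} =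
      ⋂ (j : ℕ) (k : ℕ) (_ : j < k), {p | p.2 j = true → p.1 (prefixCode p.2 k) = false} := by
    ext p; simp [Avoids]
  rw [this]
  refine isClosed_iInter fun j => isClosed_iInter fun k => isClosed_iInter fun _ => ?_
  have hev : Continuous fun p : (ℕ → Bool) × (ℕ → Bool) => p.1 (prefixCode p.2 k) := by
    rw [continuous_iff_continuousAt]
    intro p
    have h1 : ∀ᶠ q : (ℕ → Bool) × (ℕ → Bool) in nhds p,
        prefixCode q.2 k = prefixCode p.2 k := by
      have hc := (continuous_comp_prefixCode (α := Bool) (fun n : ℕ => n) k).comp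
        (continuous_snd (X := ℕ → Bool))
      exact hc.continuousAt.eventually_mem (isOpen_discrete {prefixCode p.2 k} |>.mem_nhds rfl)
    have h2 : ContinuousAt (fun q : (ℕ → Bool) × (ℕ → Bool) => q.1 (prefixCode p.2 k)) p :=
      ((continuous_apply _).comp continuous_fst).continuousAt
    exact h2.congr (h1.mono fun q hq => by simp only [hq])
  have h2 : Continuous fun p : (ℕ → Bool) × (ℕ → Bool) => (p.2 j, p.1 (prefixCode p.2 k)) :=
    ((continuous_apply j).comp continuous_snd).prodMk hev
  exact (isClosed_discrete {b : Bool × Bool | b.1 = true → b.2 = false}).preimage h2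

/-- The sequence `0ⁿ1y`. -/
def shiftSeq (y : ℕ → Bool) (n j : ℕ) : Bool :=
  if j < n then false else if j = n then true else y (j - n - 1)

/-- The first `true` stands at place `n`, so a prefix reaching beyond it reveals `n`. -/
lemma shiftSeq_agree {y y' : ℕ → Bool} {n n' k : ℕ} (hk : n < k)
    (h : ∀ j < k, shiftSeq y n j = shiftSeq y' n' j) (hk' : n' < k) : n = n' := by
  have h1 := h n hk
  have h2 := h n' hk'
  unfold shiftSeq at h1 h2
  by_contra hne
  rcases lt_or_gt_of_ne hne with hlt | hlt
  · simp [hlt] at h1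
  · simp [hlt] at h2

lemma shiftSeq_injective : Function.Injective fun p : (ℕ → Bool) × ℕ => shiftSeq p.1 p.2 := by
  rintro ⟨y, n⟩ ⟨y', n'⟩ h
  have h' : ∀ j, shiftSeq y n j = shiftSeq y' n' j := fun j => congrFun h j
  obtain rfl : n = n' := shiftSeq_agree (k := max n n' + 1) (by omega) (fun j _ => h' j) (by omega)
  congr 1
  funext i
  have := h' (i + n + 1)
  simpa [shiftSeq, show ¬ i + n + 1 < n by omega, show i + n + 1 ≠ n by omega,
    show i + n + 1 - n - 1 = i by omega] using this

lemma exists_true_lt_iff (y : ℕ → Bool) (n k : ℕ) :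
    (∃ j < k, shiftSeq y n j = true) ↔ n < k := by
  constructor
  · rintro ⟨j, hj, h⟩
    by_contra hn
    simp [shiftSeq, show j < n by omega] at h
  · intro h
    exact ⟨n, h, by simp [shiftSeq]⟩

lemma avoids_shiftSeq_iff {x y : ℕ → Bool} {n : ℕ} :
    Avoids x (shiftSeq y n) ↔ ∀ k, n < k → x (prefixCode (shiftSeq y n) k) = false := by
  constructor
  · intro h k hk
    obtain ⟨j, hj, hj'⟩ := (exists_true_lt_iff y n k).2 hk
    exact h j k hj hj'
  · intro h j k hjk hj
    exact h k ((exists_true_lt_iff y n k).1 ⟨j, hjk, hj⟩)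

end Coding

/-! ### The forcing that produces an avoiding set. -/

section Forcing

variable {Y : Type} (A : Y × ℕ → Set ℕ) (c : Set (Y × ℕ))

/-- Conditions for building a set of natural numbers that is disjoint from some of the sets `A e`,
`e ∈ c`: finitely many elements of the set together with finitely many promises. -/
def AvoidCondition : Type :=
  {p : Finset ℕ × Finset (Y × ℕ) // ∀ e ∈ p.2, e ∈ c ∧ ∀ m ∈ p.1, m ∉ A e}ᵒᵈ

instance : PartialOrder (AvoidCondition A c) :=
  inferInstanceAs (PartialOrder
    {p : Finset ℕ × Finset (Y × ℕ) // ∀ e ∈ p.2, e ∈ c ∧ ∀ m ∈ p.1, m ∉ A e}ᵒᵈ)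

variable {A c}

/-- The condition with working part `a` and promises `E`. -/
def AvoidCondition.mk (a : Finset ℕ) (E : Finset (Y × ℕ))
    (h : ∀ e ∈ E, e ∈ c ∧ ∀ m ∈ a, m ∉ A e) : AvoidCondition A c :=
  OrderDual.toDual ⟨(a, E), h⟩

/-- The working part of a condition. -/
def AvoidCondition.work (p : AvoidCondition A c) : Finset ℕ := (OrderDual.ofDual p).1.1

/-- The promises of a condition. -/
def AvoidCondition.promises (p : AvoidCondition A c) : Finset (Y × ℕ) := (OrderDual.ofDual p).1.2

lemma AvoidCondition.spec (p : AvoidCondition A c) :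
    ∀ e ∈ p.promises, e ∈ c ∧ ∀ m ∈ p.work, m ∉ A e := (OrderDual.ofDual p).2

/-- The order need not restrict new working elements: extensions retain promises, and every
condition respects its own. -/
lemma AvoidCondition.le_iff {p q : AvoidCondition A c} :
    q ≤ p ↔ p.work ⊆ q.work ∧ p.promises ⊆ q.promises := Iff.rfl

instance : Nonempty (AvoidCondition A c) := ⟨.mk ∅ ∅ (by simp)⟩

/-- Conditions with the same working part are compatible by uniting their promises, and there are
only countably many working parts. -/
lemma sigmaCentered_avoidCondition : SigmaCentered (AvoidCondition A c) := by
  classical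
  refine ⟨fun n => {p | Encodable.encode p.work = n}, ?_, ?_⟩
  · ext p; simp
  · intro n F hF
    rcases F.eq_empty_or_nonempty with rfl | ⟨p₀, hp₀⟩
    · exact ⟨.mk ∅ ∅ (by simp), by simp⟩
    have hw : ∀ p ∈ F, p.work = p₀.work := fun p hp =>
      Encodable.encode_injective ((hF hp : _ = n).trans (hF hp₀ : _ = n).symm)
    refine ⟨.mk p₀.work (F.biUnion fun p => p.promises) ?_, ?_⟩
    · intro e he
      obtain ⟨p, hp, hep⟩ := Finset.mem_biUnion.1 he
      rw [← hw p hp]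
      exact p.spec e hep
    · intro p hp
      rw [AvoidCondition.le_iff]
      exact ⟨(hw p hp).subset, Finset.subset_biUnion_of_mem (fun p => p.promises) hp⟩

/-- Under `MA_κ(σ-centered)`, a coloured almost disjoint family `A` of size `κ`, in which every
number meets only finitely many levels, admits a set of numbers that meets every member outside of
`c` and is disjoint from some `A (y, n)` with `(y, n) ∈ c` whenever there are infinitely many `n`
with `(y, n) ∈ c`. -/
theorem exists_avoiding_set {κ : Cardinal.{0}} (hω : ℵ₀ ≤ κ) (hMA : MASigmaCentered κ)
    (hY : #Y ≤ κ) (hinf : ∀ e, (A e).Infinite) (had : ∀ e e', e ≠ e' → (A e ∩ A e').Finite)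
    (hfin : ∀ m, {n | ∃ y, m ∈ A (y, n)}.Finite) :
    ∃ x : Set ℕ, (∀ e, e ∉ c → ∃ m ∈ x, m ∈ A e) ∧
      ∀ y, {n | (y, n) ∈ c}.Infinite → ∃ n, (y, n) ∈ c ∧ ∀ m ∈ x, m ∉ A (y, n) := by
  classical
  let D : (Y × ℕ) ⊕ Y → Set (AvoidCondition A c) := Sum.elim
    (fun e => {p | e ∉ c → ∃ m ∈ p.work, m ∈ A e})
    (fun y => {p | {n | (y, n) ∈ c}.Infinite → ∃ n, (y, n) ∈ p.promises})
  have hcard : #(Set.range D) ≤ κ := by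
    refine Cardinal.mk_range_le.trans ?_
    rw [Cardinal.mk_sum, Cardinal.lift_id, Cardinal.lift_id, Cardinal.mk_prod, Cardinal.lift_id,
      Cardinal.lift_id, Cardinal.mk_nat]
    exact Cardinal.add_le_of_le hω (Cardinal.mul_le_of_le hω hY hω) hY
  have hdense : ∀ E ∈ Set.range D, DenseBelow E := by
    rintro _ ⟨e | y, rfl⟩ p
    · by_cases hec : e ∈ c
      · exact ⟨p, fun h => absurd hec h, le_rfl⟩
      -- Promises lie in `c`, so they differ from `e`, and almost disjointness leaves a new element
      -- of `A e` that breaks none of them.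
      have hfin' : (⋃ e' ∈ p.promises, A e ∩ A e').Finite :=
        p.promises.finite_toSet.biUnion fun e' he' =>
          had e e' fun h => hec (h ▸ (p.spec e' he').1)
      obtain ⟨m, hm, hm'⟩ := ((hinf e).sdiff hfin').nonempty
      refine ⟨.mk (insert m p.work) p.promises ?_, fun _ => ⟨m, Finset.mem_insert_self _ _, hm⟩, ?_⟩
      · intro e' he'
        refine ⟨(p.spec e' he').1, fun l hl hl' => ?_⟩
        rcases Finset.mem_insert.1 hl with rfl | hl
        · exact hm' (Set.mem_biUnion he' ⟨hm, hl'⟩)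
        · exact (p.spec e' he').2 l hl hl'
      · rw [AvoidCondition.le_iff]
        exact ⟨Finset.subset_insert _ _, subset_rfl⟩
    · by_cases hy : {n | (y, n) ∈ c}.Infinite
      swap
      · exact ⟨p, fun h => absurd h hy, le_rfl⟩
      -- Each working element excludes only finitely many levels `n` for a new promise.
      have hfin' : (⋃ m ∈ p.work, {n | ∃ y, m ∈ A (y, n)}).Finite :=
        p.work.finite_toSet.biUnion fun m _ => hfin m
      obtain ⟨n, hn, hn'⟩ := (hy.sdiff hfin').nonempty
      refine ⟨.mk p.work (insert (y, n) p.promises) ?_,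
        fun _ => ⟨n, Finset.mem_insert_self _ _⟩, ?_⟩
      · intro e he
        rcases Finset.mem_insert.1 he with rfl | he
        · exact ⟨hn, fun m hm hm' => hn' (Set.mem_biUnion hm ⟨y, hm'⟩)⟩
        · exact p.spec e he
      · rw [AvoidCondition.le_iff]
        exact ⟨subset_rfl, Finset.subset_insert _ _⟩
  obtain ⟨G, hG⟩ := hMA (AvoidCondition A c) sigmaCentered_avoidCondition _ hcard hdense
  refine ⟨{m | ∃ p ∈ G, m ∈ p.work}, fun e he => ?_, fun y hy => ?_⟩
  · obtain ⟨p, hpG, hp⟩ := hG _ ⟨Sum.inl e, rfl⟩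
    obtain ⟨m, hm, hmA⟩ := hp he
    exact ⟨m, ⟨p, hpG, hm⟩, hmA⟩
  · obtain ⟨p, hpG, hp⟩ := hG _ ⟨Sum.inr y, rfl⟩
    obtain ⟨n, hn⟩ := hp hy
    refine ⟨n, (p.spec _ hn).1, ?_⟩
    rintro m ⟨q, hqG, hm⟩
    -- A common extension carries both the element `m` and the promise `(y, n)`.
    obtain ⟨r, -, hrp, hrq⟩ := G.directed p hpG q hqG
    exact (r.spec _ ((AvoidCondition.le_iff.1 hrp).2 hn)).2 m ((AvoidCondition.le_iff.1 hrq).1 hm)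

end Forcing

/-! ### Monochromatic sets of avoided sequences. -/

/-- Under `MA_κ(σ-centered)` there is a set `Z` of sequences such that for each set `C` some `x`
avoids at least `κ` members of `Z`, and these all lie in `C` or all lie outside of `C`. -/
theorem exists_index_set {κ : Cardinal.{0}} (hω : ℵ₀ ≤ κ) (hκ : κ < 2 ^ ℵ₀)
    (hMA : MASigmaCentered κ) :
    ∃ Z : Set (ℕ → Bool), (∀ z ∈ Z, ∃ j, z j = true) ∧ ∀ C : Set (ℕ → Bool), ∃ x : ℕ → Bool,
      κ ≤ #{z | z ∈ Z ∧ Avoids x z} ∧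
      ((∀ z ∈ Z, Avoids x z → z ∈ C) ∨ ∀ z ∈ Z, Avoids x z → z ∉ C) := by
  classical
  obtain ⟨Y, hY⟩ : ∃ Y : Set (ℕ → Bool), #Y = κ := by
    apply Cardinal.le_mk_iff_exists_set.1
    simpa using hκ.le
  let ζ : Y × ℕ → ℕ → Bool := fun e => shiftSeq e.1 e.2
  have hζ : Function.Injective ζ := by
    rintro ⟨y, n⟩ ⟨y', n'⟩ h
    have := shiftSeq_injective (a₁ := (y.1, n)) (a₂ := (y'.1, n')) h
    simp only [Prod.mk.injEq] at this
    exact Prod.ext (Subtype.ext this.1) this.2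
  let A : Y × ℕ → Set ℕ := fun e => {m | ∃ k, e.2 < k ∧ m = prefixCode (ζ e) k}
  have hinf : ∀ e, (A e).Infinite := fun e => by
    refine ((Set.Ioi_infinite e.2).image (f := prefixCode (ζ e)) ?_).mono ?_
    · intro k _ l _ h
      exact (prefixCode_eq_iff.1 h).1
    · rintro _ ⟨k, hk, rfl⟩
      exact ⟨k, hk, rfl⟩
  have had : ∀ e e', e ≠ e' → (A e ∩ A e').Finite := fun e e' hne => by
    obtain ⟨N, hN⟩ := Filter.eventually_atTop.1 (eventually_prefixCode_inj (ζ e) (ζ e'))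
    refine ((Set.finite_lt_nat N).image (prefixCode (ζ e))).subset ?_
    rintro m ⟨⟨k, -, rfl⟩, l, -, hl⟩
    obtain rfl := (prefixCode_eq_iff.1 hl).1
    refine ⟨k, ?_, rfl⟩
    by_contra hk
    exact hne (hζ (hN k (not_lt.1 hk) hl))
  have hfin : ∀ m, {n | ∃ y, m ∈ A (y, n)}.Finite := fun m => by
    apply Set.Subsingleton.finite
    rintro n ⟨y, k, hk, rfl⟩ n' ⟨y', k', hk', h⟩
    obtain ⟨rfl, hagree⟩ := prefixCode_eq_iff.1 h
    exact shiftSeq_agree hk hagree hk'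
  have key : ∀ c : Set (Y × ℕ), κ ≤ #{y : Y | {n | (y, n) ∈ c}.Infinite} →
      ∃ x : ℕ → Bool, κ ≤ #{z | z ∈ Set.range ζ ∧ Avoids x z} ∧
        ∀ e, Avoids x (ζ e) → e ∈ c := by
    intro c hc
    obtain ⟨x, hx, hx'⟩ := exists_avoiding_set (c := c) hω hMA hY.le hinf had hfin
    have hav : ∀ e, Avoids (fun m => decide (m ∈ x)) (ζ e) ↔ ∀ m ∈ x, m ∉ A e := fun e => by
      rw [show ζ e = shiftSeq e.1 e.2 from rfl, avoids_shiftSeq_iff]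
      constructor
      · rintro h m hm ⟨k, hk, rfl⟩
        simpa [ζ] using (of_decide_eq_false (h k hk)) hm
      · intro h k hk
        exact decide_eq_false fun hm => h _ hm ⟨k, hk, rfl⟩
    refine ⟨fun m => decide (m ∈ x), hc.trans ?_, fun e he => ?_⟩
    · choose n hn hn' using hx'
      refine Cardinal.mk_le_of_injective
        (f := fun y : {y : Y | {n | (y, n) ∈ c}.Infinite} =>
          (⟨ζ (y.1, n y.1 y.2), ⟨_, rfl⟩, (hav _).2 (hn' y.1 y.2)⟩ :
            {z | z ∈ Set.range ζ ∧ Avoids (fun m => decide (m ∈ x)) z})) ?_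
      intro y y' h
      have := hζ (Subtype.ext_iff.1 h)
      exact Subtype.ext (congrArg Prod.fst this)
    · by_contra hec
      obtain ⟨m, hm, hmA⟩ := hx e hec
      exact (hav e).1 he m hm hmA
  refine ⟨Set.range ζ, ?_, fun C => ?_⟩
  · rintro _ ⟨e, rfl⟩
    exact ⟨e.2, by simp [ζ, shiftSeq]⟩
  -- Every `y` belongs to one of the two sets, and two sets smaller than the infinite `κ` cannot
  -- cover `Y`.
  have hcover : κ ≤ #{y : Y | {n | (y, n) ∈ ζ ⁻¹' C}.Infinite} ∨
      κ ≤ #{y : Y | {n | (y, n) ∈ (ζ ⁻¹' C)ᶜ}.Infinite} := by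
    by_contra! h
    have huniv : {y : Y | {n | (y, n) ∈ ζ ⁻¹' C}.Infinite} ∪
        {y : Y | {n | (y, n) ∈ (ζ ⁻¹' C)ᶜ}.Infinite} = Set.univ := by
      refine Set.eq_univ_of_forall fun y => ?_
      by_contra hy
      simp only [Set.mem_union, Set.mem_ofPred_eq, not_or, Set.not_infinite] at hy
      refine Set.infinite_univ ((hy.1.union hy.2).subset fun n _ => ?_)
      exact em ((y, n) ∈ ζ ⁻¹' C)
    have hle := Cardinal.mk_union_le {y : Y | {n | (y, n) ∈ ζ ⁻¹' C}.Infinite}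
      {y : Y | {n | (y, n) ∈ (ζ ⁻¹' C)ᶜ}.Infinite}
    rw [huniv, Cardinal.mk_univ, hY] at hle
    exact hle.not_gt (Cardinal.add_lt_of_lt hω h.1 h.2)
  rcases hcover with h | h
  · obtain ⟨x, hx, hx'⟩ := key _ h
    refine ⟨x, hx, Or.inl ?_⟩
    rintro _ ⟨e, rfl⟩ he
    exact hx' e he
  · obtain ⟨x, hx, hx'⟩ := key _ h
    refine ⟨x, hx, Or.inr ?_⟩
    rintro _ ⟨e, rfl⟩ he
    exact hx' e he


/-! ### Covers from an embedded Cantor set. -/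

/-- Distinct sequences whose prefixes contain `true` are avoided by different sets of points. -/
lemma avoids_separates {z z' : ℕ → Bool} (h : {x | Avoids x z} = {x | Avoids x z'})
    {j : ℕ} (hj : z j = true) : z = z' := by
  obtain ⟨k, hk, hjk⟩ :=
    ((eventually_prefixCode_inj z z').and (Filter.eventually_gt_atTop j)).exists
  by_contra hne
  -- The singleton of the code of a long prefix of `z` avoids `z'` but not `z`.
  have hmem : (fun m => decide (m = prefixCode z k)) ∈ {x | Avoids x z'} := by
    intro i l _ _
    refine decide_eq_false fun hl => hne (hk ?_)
    rw [← hl, (prefixCode_eq_iff.1 hl).1]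
  rw [← h] at hmem
  simpa using hmem j k hjk hj

/-- A Hausdorff space with an embedded Cantor set whose complement has at least `κ` points has an
unsplittable `κ`-fold closed cover. -/
theorem exists_unsplittable_of_cantor {κ : Cardinal.{0}} (hω : ℵ₀ ≤ κ) (hκ : κ < 2 ^ ℵ₀)
    (hMA : MASigmaCentered κ) {X : Type} [TopologicalSpace X] [T2Space X]
    {ι : (ℕ → Bool) → X} (hι : Continuous ι) (hinj : Function.Injective ι)
    (hcompl : κ ≤ #((Set.range ι)ᶜ : Set X)) :
    ∃ 𝓗 : Set (Set X), IsUnsplittableClosedCover κ 𝓗 := by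
  obtain ⟨Z, hZ, hZC⟩ := exists_index_set hω hκ hMA
  let H : (ℕ → Bool) → Set X := fun z => ι '' {x | Avoids x z}
  let S : Set X := ι '' {x | κ ≤ #{z | z ∈ Z ∧ Avoids x z}}
  have hHinj : Set.InjOn H Z := by
    intro z hz z' _ h
    obtain ⟨j, hj⟩ := hZ z hz
    exact avoids_separates (hinj.image_injective h) hj
  -- The pairs `{a, b}` with fixed `a ∉ S` and `b` off the Cantor set already cover `a` at least `κ`
  -- times.
  refine ⟨H '' Z ∪ {T | ∃ a ∉ S, ∃ b ∉ S, T = {a, b}}, ?_, ?_, ?_⟩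
  · rintro _ (⟨z, -, rfl⟩ | ⟨a, -, b, -, rfl⟩)
    · have : IsClosed {x | Avoids x z} :=
        isClosed_avoids.preimage (f := fun x => (x, z)) (by fun_prop)
      exact (this.isCompact.image hι).isClosed
    · exact (Set.toFinite _).isClosed
  · intro a
    by_cases ha : a ∈ S
    · obtain ⟨x, hx, rfl⟩ := ha
      refine le_trans (hx : κ ≤ _) (Cardinal.mk_le_of_injective
        (f := fun z : {z | z ∈ Z ∧ Avoids x z} =>
          ⟨H z.1, Or.inl ⟨z.1, z.2.1, rfl⟩, ⟨x, z.2.2, rfl⟩⟩) ?_)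
      intro z z' h
      exact Subtype.ext (hHinj z.2.1 z'.2.1 (Subtype.ext_iff.1 h))
    · have hS : ∀ b : ((Set.range ι)ᶜ : Set X), b.1 ∉ S := fun b hb =>
        b.2 (Set.image_subset_range _ _ hb)
      refine hcompl.trans (Cardinal.mk_le_of_injective
        (f := fun b : ((Set.range ι)ᶜ : Set X) =>
          ⟨{a, b.1}, Or.inr ⟨a, ha, b.1, hS b, rfl⟩, by simp⟩) ?_)
      intro b b' h
      have h' : ({a, b.1} : Set X) = {a, b'.1} := Subtype.ext_iff.1 h
      rw [Set.pair_eq_pair_iff] at h'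
      rcases h' with h' | h'
      · exact Subtype.ext h'.2
      · exact Subtype.ext (h'.2.trans h'.1)
  · rintro ⟨𝓐, 𝓑, hA, hB, hdisj, hcA, hcB⟩
    -- Only sets `H z` contain `ι x`, and they are all in `𝓐` or all outside it; so `𝓑` or `𝓐`
    -- misses `ι x`.
    obtain ⟨x, hx, hmono⟩ := hZC {z | H z ∈ 𝓐}
    have hform : ∀ T, T ∈ H '' Z ∪ {T | ∃ a ∉ S, ∃ b ∉ S, T = {a, b}} → ι x ∈ T →
        ∃ z ∈ Z, Avoids x z ∧ T = H z := by
      rintro _ (⟨z, hz, rfl⟩ | ⟨a, ha, b, hb, rfl⟩) hT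
      · obtain ⟨x', hx', he⟩ := hT
        exact ⟨z, hz, hinj he ▸ hx', rfl⟩
      · have hxS : ι x ∈ S := ⟨x, hx, rfl⟩
        rcases hT with rfl | rfl
        · exact absurd hxS ha
        · exact absurd hxS hb
    rcases hmono with hm | hm
    · obtain ⟨T, hT, hxT⟩ := hcB (ι x)
      obtain ⟨z, hz, hav, rfl⟩ := hform T (hB hT) hxT
      exact Set.disjoint_left.1 hdisj (hm z hz hav) hT
    · obtain ⟨T, hT, hxT⟩ := hcA (ι x)
      obtain ⟨z, hz, hav, rfl⟩ := hform T (hA hT) hxT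
      exact hm z hz hav hT

theorem exists_unsplittable_baire {κ : Cardinal.{0}} (hω : ℵ₀ ≤ κ) (hκ : κ < 2 ^ ℵ₀)
    (hMA : MASigmaCentered κ) :
    ∃ 𝓗 : Set (Set (ℕ → ℕ)), IsUnsplittableClosedCover κ 𝓗 := by
  refine exists_unsplittable_of_cantor hω hκ hMA (ι := fun x n => (x n).toNat) ?_ ?_ ?_
  · exact continuous_pi fun n =>
      (continuous_of_discreteTopology (f := Bool.toNat)).comp (continuous_apply n)
  · intro x y h
    funext n
    exact bool_toNat_injective (congrFun h n)
  · have : κ ≤ #(ℕ → ℕ) := by simpa using hκ.le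
    refine this.trans (Cardinal.mk_le_of_injective (f := fun w => ⟨fun n => w n + 2, ?_⟩) ?_)
    · rintro ⟨x, hx⟩
      have h1 : (x 0).toNat = w 0 + 2 := congrFun hx 0
      have h2 := Bool.toNat_le (x 0)
      omega
    · intro w w' h
      funext n
      have : w n + 2 = w' n + 2 := congrFun (Subtype.ext_iff.1 h) n
      omega

theorem exists_unsplittable_cantor {κ : Cardinal.{0}} (hω : ℵ₀ ≤ κ) (hκ : κ < 2 ^ ℵ₀)
    (hMA : MASigmaCentered κ) :
    ∃ 𝓗 : Set (Set (ℕ → Bool)), IsUnsplittableClosedCover κ 𝓗 := by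
  let cons : Bool → (ℕ → Bool) → ℕ → Bool := fun b x n => Nat.casesOn n b x
  have hcons : ∀ b, Function.Injective (cons b) := fun b x y h =>
    funext fun n => congrFun h (n + 1)
  refine exists_unsplittable_of_cantor hω hκ hMA (ι := cons false) ?_ (hcons _) ?_
  · refine continuous_pi fun n => ?_
    cases n with
    | zero => exact continuous_const
    | succ n => exact continuous_apply n
  · have : κ ≤ #(ℕ → Bool) := by simpa using hκ.le
    refine this.trans (Cardinal.mk_le_of_injective (f := fun w => ⟨cons true w, ?_⟩) ?_)
    · rintro ⟨x, hx⟩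
      exact Bool.false_ne_true (congrFun hx 0)
    · intro w w' h
      exact hcons true (Subtype.ext_iff.1 h)


/-! ### Cantor sets of reals with unique short sums. -/

section DigitSums

lemma summable_digits {h : ℕ → ℤ} {b : ℤ} (hb : ∀ n, |h n| ≤ b) :
    Summable fun n => (h n : ℝ) * (1 / 10) ^ n := by
  refine Summable.of_norm_bounded (g := fun n => (b : ℝ) * (1 / 10) ^ n)
    ((summable_geometric_of_lt_one (by norm_num) (by norm_num)).mul_left _) fun n => ?_
  rw [norm_mul, norm_pow, Real.norm_eq_abs, Real.norm_of_nonneg (by norm_num : (0:ℝ) ≤ 1 / 10)]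
  gcongr
  exact_mod_cast hb n

/-- A decimal series with integer digits of absolute value at most `4` vanishes only if all digits
do. -/
lemma digits_eq_zero (n : ℕ) : ∀ h : ℕ → ℤ, (∀ n, |h n| ≤ 4) →
    ∑' n, (h n : ℝ) * (1 / 10) ^ n = 0 → h n = 0 := by
  have key : ∀ h : ℕ → ℤ, (∀ n, |h n| ≤ 4) → ∑' n, (h n : ℝ) * (1 / 10) ^ n = 0 →
      h 0 = 0 ∧ ∑' n, (h (n + 1) : ℝ) * (1 / 10) ^ n = 0 := by
    intro h hb hs
    -- The tail is at most `40/9`, so after scaling by `1/10` it forces `|h 0| ≤ 4/9 < 1`.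
    have hT : |∑' n, (h (n + 1) : ℝ) * (1 / 10) ^ n| ≤ 4 * (1 - 1 / 10)⁻¹ := by
      rw [← Real.norm_eq_abs]
      refine tsum_of_norm_bounded (g := fun n => (4 : ℝ) * (1 / 10) ^ n)
        ((hasSum_geometric_of_lt_one (by norm_num) (by norm_num)).mul_left _) fun n => ?_
      rw [norm_mul, norm_pow, Real.norm_eq_abs,
        Real.norm_of_nonneg (by norm_num : (0:ℝ) ≤ 1 / 10)]
      gcongr
      exact_mod_cast hb (n + 1)
    rw [(summable_digits hb).tsum_eq_zero_add] at hs
    have hshift : ∑' n, (h (n + 1) : ℝ) * (1 / 10) ^ (n + 1) =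
        (1 / 10) * ∑' n, (h (n + 1) : ℝ) * (1 / 10) ^ n := by
      rw [← tsum_mul_left]
      exact tsum_congr fun n => by ring
    rw [hshift, pow_zero, mul_one] at hs
    set T := ∑' n, (h (n + 1) : ℝ) * (1 / 10) ^ n
    have h0 : h 0 = 0 := by
      have hlt : |(h 0 : ℝ)| < 1 := by
        rw [abs_le] at hT
        rw [abs_lt]
        constructor <;> [have := hT.2; have := hT.1] <;> norm_num at this <;> linarith
      exact Int.abs_lt_one_iff.1 (by exact_mod_cast hlt)
    refine ⟨h0, ?_⟩
    rw [h0] at hs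
    simp at hs
    exact hs
  induction n with
  | zero => exact fun h hb hs => (key h hb hs).1
  | succ n ih => exact fun h hb hs => ih (fun n => h (n + 1)) (fun n => hb _) (key h hb hs).2

/-- The set of codes of prefixes of `w`. -/
def prefixSet (w : ℕ → ℕ) : Set ℕ := Set.range (prefixCode w)

open Classical in
/-- The real number whose decimal digits form the characteristic function of the set of codes of
prefixes of `w`. -/
noncomputable def digitReal (w : ℕ → ℕ) : ℝ :=
  ∑' n, ((if n ∈ prefixSet w then 1 else 0 : ℤ) : ℝ) * (1 / 10) ^ n

open Classical in
lemma sum_digitReal (M : Multiset (ℕ → ℕ)) : (M.map digitReal).sum =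
    ∑' n, ((M.countP (fun w => n ∈ prefixSet w) : ℤ) : ℝ) * (1 / 10) ^ n := by
  induction M using Multiset.induction_on with
  | empty => simp
  | cons w M ih =>
    rw [Multiset.map_cons, Multiset.sum_cons, ih, digitReal, ← Summable.tsum_add]
    · refine tsum_congr fun n => ?_
      rw [Multiset.countP_cons]
      split_ifs <;> push_cast <;> ring
    · refine summable_digits (b := 1) fun n => ?_
      split_ifs <;> simp
    · refine summable_digits (b := M.card) fun n => ?_
      rw [Nat.abs_cast]
      exact_mod_cast Multiset.countP_le_card _ _

open Classical in
/-- Sums of at most four of the reals `digitReal w` determine their summands. -/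
theorem multiset_eq_of_sum_digitReal {A B : Multiset (ℕ → ℕ)} (hA : A.card ≤ 4) (hB : B.card ≤ 4)
    (h : (A.map digitReal).sum = (B.map digitReal).sum) : A = B := by
  have hbound : ∀ (M : Multiset (ℕ → ℕ)) (n : ℕ),
      |(M.countP (fun w => n ∈ prefixSet w) : ℤ)| ≤ M.card := fun M n => by
    rw [Nat.abs_cast]
    exact_mod_cast Multiset.countP_le_card _ _
  have hcount : ∀ n, A.countP (fun w => n ∈ prefixSet w) = B.countP (fun w => n ∈ prefixSet w) := by
    intro n
    have := digits_eq_zero n (fun n => (A.countP (fun w => n ∈ prefixSet w) : ℤ) -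
      B.countP (fun w => n ∈ prefixSet w)) (fun n => ?_) ?_
    · have := sub_eq_zero.1 this
      exact_mod_cast this
    · have h1 := Multiset.countP_le_card (fun w => n ∈ prefixSet w) A
      have h2 := Multiset.countP_le_card (fun w => n ∈ prefixSet w) B
      rw [abs_le]
      constructor <;> omega
    · rw [sum_digitReal, sum_digitReal] at h
      rw [← sub_eq_zero, ← Summable.tsum_sub (summable_digits (hbound A))
        (summable_digits (hbound B))] at h
      rw [← h]
      refine tsum_congr fun n => ?_
      push_cast
      ring
  ext w
  -- For large `k` no other summand shares the prefix of `w` of length `k`, so the digit at its code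
  -- counts the multiplicity of `w`.
  have hev : ∀ᶠ k in Filter.atTop, ∀ w' ∈ (A + B).toFinset,
      prefixCode w' k = prefixCode w k → w' = w :=
    (Filter.eventually_all_finset _).2 fun w' _ => eventually_prefixCode_inj w' w
  obtain ⟨k, hk⟩ := hev.exists
  have hcnt : ∀ M : Multiset (ℕ → ℕ), M ≤ A + B →
      M.countP (fun w' => prefixCode w k ∈ prefixSet w') = M.count w := fun M hM => by
    rw [Multiset.count]
    refine Multiset.countP_congr rfl fun w' hw' => ?_
    refine propext ⟨?_, fun h => h ▸ ⟨k, rfl⟩⟩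
    rintro ⟨l, hl⟩
    obtain rfl := (prefixCode_eq_iff.1 hl).1
    exact (hk w' (Multiset.mem_toFinset.2 (Multiset.mem_of_le hM hw')) hl).symm
  rw [← hcnt A (Multiset.le_add_right _ _), ← hcnt B (Multiset.le_add_left _ _), hcount]

/-- Each digit depends on finitely many coordinates, and the series converges uniformly. -/
lemma continuous_digitReal : Continuous digitReal := by
  classical
  have hcode : ∀ n : ℕ, Continuous fun w : ℕ → ℕ =>
      ((if n ∈ prefixSet w then 1 else 0 : ℤ) : ℝ) * (1 / 10) ^ n := by
    intro n
    by_cases hn : ∃ (v : ℕ → ℕ) (k : ℕ), prefixCode v k = n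
    · obtain ⟨v, k, rfl⟩ := hn
      have heq : ∀ w : ℕ → ℕ, prefixCode v k ∈ prefixSet w ↔ prefixCode w k = prefixCode v k := by
        refine fun w => ⟨?_, fun h => ⟨k, h⟩⟩
        rintro ⟨l, hl⟩
        rw [← hl, (prefixCode_eq_iff.1 hl).1]
      simp only [heq]
      exact continuous_comp_prefixCode
        (fun m => ((if m = prefixCode v k then 1 else 0 : ℤ) : ℝ) * (1 / 10) ^ prefixCode v k) k
    · have : ∀ w : ℕ → ℕ, n ∉ prefixSet w := fun w ⟨k, hk⟩ => hn ⟨w, k, hk⟩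
      simp only [this, if_false]
      exact continuous_const
  refine continuous_tsum hcode
    (summable_geometric_of_lt_one (r := 1 / 10) (by norm_num) (by norm_num)) fun n w => ?_
  rw [norm_mul, norm_pow, Real.norm_of_nonneg (by norm_num : (0:ℝ) ≤ 1 / 10)]
  refine mul_le_of_le_one_left (by positivity) ?_
  split_ifs <;> simp

/-- The binary sequence `x` with its values tagged by `i`. -/
def tagged (i : Fin 3) (x : ℕ → Bool) (n : ℕ) : ℕ := 3 * (x n).toNat + i

lemma tagged_eq_iff {i j : Fin 3} {x y : ℕ → Bool} :
    tagged i x = tagged j y ↔ i = j ∧ x = y := by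
  refine ⟨fun h => ?_, fun h => by rw [h.1, h.2]⟩
  have h' : ∀ n, 3 * (x n).toNat + (i : ℕ) = 3 * (y n).toNat + j := fun n => congrFun h n
  obtain rfl : i = j := by have := h' 0; omega
  exact ⟨rfl, funext fun n => bool_toNat_injective (by have := h' n; omega)⟩

/-- Three disjoint Cantor sets in the line whose union is additively independent in the sense of
`multiset_eq_of_sum_digitReal`. -/
noncomputable def taggedReal (i : Fin 3) (x : ℕ → Bool) : ℝ := digitReal (tagged i x)

lemma continuous_taggedReal (i : Fin 3) : Continuous (taggedReal i) :=
  continuous_digitReal.comp <| continuous_pi fun n =>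
    (continuous_of_discreteTopology (f := fun b : Bool => 3 * b.toNat + (i : ℕ))).comp
      (continuous_apply n)

lemma taggedReal_injective (i : Fin 3) : Function.Injective (taggedReal i) := by
  intro x y h
  have := multiset_eq_of_sum_digitReal (A := {tagged i x}) (B := {tagged i y}) (by simp) (by simp)
    (by simpa [taggedReal] using h)
  exact (tagged_eq_iff.1 (Multiset.singleton_inj.1 this)).2

/-- Moving the negative terms across gives two equal sums of two reals; the tags then match the
summands. -/
lemma taggedReal_sub_eq_sub {q q' p p' : ℕ → Bool}
    (h : taggedReal 1 q - taggedReal 0 p = taggedReal 1 q' - taggedReal 0 p') :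
    q = q' ∧ p = p' := by
  have := multiset_eq_of_sum_digitReal (A := {tagged 1 q, tagged 0 p'})
    (B := {tagged 1 q', tagged 0 p}) (by simp) (by simp)
    (by simp [taggedReal] at h ⊢; linarith)
  have h1 : tagged 1 q ∈ ({tagged 1 q', tagged 0 p} : Multiset _) := this ▸ by simp
  have h2 : tagged 0 p ∈ ({tagged 1 q, tagged 0 p'} : Multiset _) := this ▸ by simp
  simp [tagged_eq_iff] at h1 h2
  exact ⟨h1, h2⟩

lemma taggedReal_sub_ne {q p k : ℕ → Bool} :
    taggedReal 1 q - taggedReal 0 p ≠ taggedReal 2 k := by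
  intro h
  have := multiset_eq_of_sum_digitReal (A := {tagged 1 q})
    (B := {tagged 2 k, tagged 0 p}) (by simp) (by simp)
    (by simp [taggedReal] at h ⊢; linarith)
  simpa using congrArg Multiset.card this

end DigitSums

/-! ### Covers of the line by translates. -/

/-- Translates of a nonempty compact set of reals by different numbers are different. -/
lemma translate_injective {K : Set ℝ} (hK : IsCompact K) (hne : K.Nonempty) {d e : ℝ}
    (h : (fun x => x + d) '' K = (fun x => x + e) '' K) : d = e := by
  obtain ⟨M, hM⟩ := hK.exists_isGreatest hne
  have : ∀ d : ℝ, IsGreatest ((fun x => x + d) '' K) (M + d) := fun d =>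
    Monotone.map_isGreatest (f := fun x => x + d) (fun _ _ hxy => by simpa using hxy) hM
  have := (this d).unique (h ▸ this e)
  linarith

/-- The compact set whose translates form an unsplittable cover of the line. -/
def coverSet : Set ℝ :=
  (fun p : (ℕ → Bool) × (ℕ → Bool) => taggedReal 1 p.1 - taggedReal 0 p.2) ''
    {p | Avoids p.1 p.2} ∪ Set.range (taggedReal 2)

lemma isCompact_coverSet : IsCompact coverSet :=
  (isClosed_avoids.isCompact.image
    (((continuous_taggedReal 1).comp continuous_fst).sub
      ((continuous_taggedReal 0).comp continuous_snd))).union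
    (isCompact_range (continuous_taggedReal 2))

lemma taggedReal_sub_mem_coverSet {x z : ℕ → Bool} :
    taggedReal 1 x - taggedReal 0 z ∈ coverSet ↔ Avoids x z := by
  constructor
  · rintro (⟨⟨x', z'⟩, hav, h⟩ | ⟨k, hk⟩)
    · obtain ⟨rfl, rfl⟩ := taggedReal_sub_eq_sub h
      exact hav
    · exact absurd hk.symm taggedReal_sub_ne
  · exact fun h => Or.inl ⟨(x, z), h, rfl⟩

/-- A real outside of `taggedReal 1 '' S` has at most one representation `k + s - c` with
`k` in the third Cantor set, `s` in `taggedReal 1 '' S` and `c` in `coverSet`. -/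
lemma subsingleton_representations {S : Set (ℕ → Bool)} {r : ℝ} (hr : r ∉ taggedReal 1 '' S) :
    {k | ∃ s ∈ S, taggedReal 1 s - (r - taggedReal 2 k) ∈ coverSet}.Subsingleton := by
  -- Eliminating `r` from the two representations leaves an equation between sums of at most four
  -- tagged reals. The mixed cases fail by counting summands. In the last case `k = l` would give `r
  -- = taggedReal 1 s`.
  rintro k ⟨s, hs, ⟨⟨q, p⟩, -, h⟩ | ⟨l, h⟩⟩ k' ⟨s', hs', ⟨⟨q', p'⟩, -, h'⟩ | ⟨l', h'⟩⟩
  · have := multiset_eq_of_sum_digitReal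
      (A := {tagged 2 k, tagged 1 s, tagged 1 q', tagged 0 p})
      (B := {tagged 2 k', tagged 1 s', tagged 1 q, tagged 0 p'}) (by simp) (by simp)
      (by simp [taggedReal] at h h' ⊢; linarith)
    have h1 : tagged 2 k ∈
      ({tagged 2 k', tagged 1 s', tagged 1 q, tagged 0 p'} : Multiset _) := this ▸ by simp
    simpa [tagged_eq_iff] using h1
  · have := multiset_eq_of_sum_digitReal
      (A := {tagged 2 k, tagged 1 s, tagged 2 l', tagged 0 p})
      (B := {tagged 2 k', tagged 1 s', tagged 1 q}) (by simp) (by simp)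
      (by simp [taggedReal] at h h' ⊢; linarith)
    simpa using congrArg Multiset.card this
  · have := multiset_eq_of_sum_digitReal
      (A := {tagged 2 k, tagged 1 s, tagged 1 q'})
      (B := {tagged 2 k', tagged 1 s', tagged 2 l, tagged 0 p'}) (by simp) (by simp)
      (by simp [taggedReal] at h h' ⊢; linarith)
    simpa using congrArg Multiset.card this
  · have := multiset_eq_of_sum_digitReal
      (A := {tagged 2 k, tagged 1 s, tagged 2 l'})
      (B := {tagged 2 k', tagged 1 s', tagged 2 l}) (by simp) (by simp)
      (by simp [taggedReal] at h h' ⊢; linarith)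
    have h1 : tagged 2 k ∈
      ({tagged 2 k', tagged 1 s', tagged 2 l} : Multiset _) := this ▸ by simp
    simp [tagged_eq_iff] at h1
    rcases h1 with h1 | rfl
    · exact h1
    · exact absurd ⟨s, hs, by linarith⟩ hr

/-- The line has an unsplittable `κ`-fold cover by translates of `coverSet`. -/
theorem exists_unsplittable_translates {κ : Cardinal.{0}} (hω : ℵ₀ ≤ κ) (hκ : κ < 2 ^ ℵ₀)
    (hMA : MASigmaCentered κ) :
    ∃ 𝓗 : Set (Set ℝ), (∀ H ∈ 𝓗, ∃ d : ℝ, H = (fun x => x + d) '' coverSet) ∧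
      IsUnsplittableClosedCover κ 𝓗 := by
  obtain ⟨Z, -, hZC⟩ := exists_index_set hω hκ hMA
  let S : Set (ℕ → Bool) := {x | κ ≤ #{z | z ∈ Z ∧ Avoids x z}}
  -- Besides the coding translates, all translates that miss `taggedReal 1 '' S` are admitted.
  let D : Set ℝ := taggedReal 0 '' Z ∪ {d | ∀ s ∈ S, taggedReal 1 s - d ∉ coverSet}
  let T : ℝ → Set ℝ := fun d => (fun x => x + d) '' coverSet
  have hT : ∀ r d, r ∈ T d ↔ r - d ∈ coverSet := fun r d => by
    constructor
    · rintro ⟨c, hc, rfl⟩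
      simpa using hc
    · exact fun h => ⟨r - d, h, by simp⟩
  have hTinj : Function.Injective T := fun d e h =>
    translate_injective isCompact_coverSet ⟨_, Or.inr ⟨fun _ => true, rfl⟩⟩ h
  refine ⟨T '' D, ?_, ?_, ?_, ?_⟩
  · rintro _ ⟨d, -, rfl⟩
    exact ⟨d, rfl⟩
  · rintro _ ⟨d, -, rfl⟩
    exact (isCompact_coverSet.image (continuous_id.add continuous_const)).isClosed
  · intro r
    by_cases hr : r ∈ taggedReal 1 '' S
    · obtain ⟨x, hx, rfl⟩ := hr
      refine le_trans (hx : κ ≤ _) (Cardinal.mk_le_of_injective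
        (f := fun z : {z | z ∈ Z ∧ Avoids x z} =>
          ⟨T (taggedReal 0 z.1), ⟨_, Or.inl ⟨z.1, z.2.1, rfl⟩, rfl⟩,
            (hT _ _).2 (taggedReal_sub_mem_coverSet.2 z.2.2)⟩) ?_)
      intro z z' h
      exact Subtype.ext (taggedReal_injective 0 (hTinj (Subtype.ext_iff.1 h)))
    -- The translate by `r - taggedReal 2 k` contains `r`, and it is admitted for all `k` with at
    -- most one exception.
    · set B := {k | ∃ s ∈ S, taggedReal 1 s - (r - taggedReal 2 k) ∈ coverSet} with hB
      have hBc : κ ≤ #(Bᶜ : Set (ℕ → Bool)) := by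
        have hfin : B.Finite := (subsingleton_representations hr).finite
        have hcard : #(Bᶜ : Set (ℕ → Bool)) = #(ℕ → Bool) := by
          apply Cardinal.mk_compl_of_infinite
          exact hfin.lt_aleph0.trans_le (Cardinal.aleph0_le_mk _)
        rw [hcard]
        simpa using hκ.le
      refine hBc.trans (Cardinal.mk_le_of_injective
        (f := fun k : (Bᶜ : Set (ℕ → Bool)) =>
          ⟨T (r - taggedReal 2 k.1), ⟨_, Or.inr fun s hs hmem => k.2 ⟨s, hs, hmem⟩, rfl⟩,
            (hT _ _).2 (by rw [sub_sub_cancel]; exact Or.inr ⟨k.1, rfl⟩)⟩) ?_)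
      intro k k' h
      have := hTinj (Subtype.ext_iff.1 h)
      exact Subtype.ext (taggedReal_injective 2 (sub_right_injective this))
  · rintro ⟨𝓐, 𝓑, hA, hB, hdisj, hcA, hcB⟩
    obtain ⟨x, hx, hmono⟩ := hZC {z | T (taggedReal 0 z) ∈ 𝓐}
    have hform : ∀ H ∈ T '' D, taggedReal 1 x ∈ H →
        ∃ z ∈ Z, Avoids x z ∧ H = T (taggedReal 0 z) := by
      rintro _ ⟨_, ⟨z, hz, rfl⟩ | hd, rfl⟩ hmem
      · exact ⟨z, hz, taggedReal_sub_mem_coverSet.1 ((hT _ _).1 hmem), rfl⟩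
      · exact absurd ((hT _ _).1 hmem) (hd x hx)
    rcases hmono with hm | hm
    · obtain ⟨H, hH, hxH⟩ := hcB (taggedReal 1 x)
      obtain ⟨z, hz, hav, rfl⟩ := hform H (hB hH) hxH
      exact Set.disjoint_left.1 hdisj (hm z hz hav) hH
    · obtain ⟨H, hH, hxH⟩ := hcA (taggedReal 1 x)
      obtain ⟨z, hz, hav, rfl⟩ := hform H (hA hH) hxH
      exact hm z hz hav hH

end SplittingCovers

/-- The Baire space `ω^ω` is `ℕ → ℕ` and the Cantor space `2^ω` is `ℕ → Bool`, with the product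
topologies of discrete spaces. -/
theorem theorem6p1 (κ : Cardinal.{0}) (hω : ℵ₀ ≤ κ) (hκ : κ < 2 ^ ℵ₀)
    (hMA : SplittingCovers.MASigmaCentered κ) :
    (∃ 𝓗 : Set (Set ℝ), SplittingCovers.IsUnsplittableClosedCover κ 𝓗) ∧
    (∃ 𝓗 : Set (Set (ℕ → ℕ)), SplittingCovers.IsUnsplittableClosedCover κ 𝓗) ∧
    (∃ 𝓗 : Set (Set (ℕ → Bool)), SplittingCovers.IsUnsplittableClosedCover κ 𝓗) ∧
    (∃ K : Set ℝ, IsCompact K ∧ ∃ 𝓗 : Set (Set ℝ),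
      (∀ H ∈ 𝓗, ∃ d : ℝ, H = (fun x => x + d) '' K) ∧
      SplittingCovers.IsUnsplittableClosedCover κ 𝓗) := by
  obtain ⟨𝓗, htrans, h𝓗⟩ := SplittingCovers.exists_unsplittable_translates hω hκ hMA
  exact ⟨⟨𝓗, h𝓗⟩, SplittingCovers.exists_unsplittable_baire hω hκ hMA,
    SplittingCovers.exists_unsplittable_cantor hω hκ hMA,
    SplittingCovers.coverSet, SplittingCovers.isCompact_coverSet, 𝓗, htrans, h𝓗⟩
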